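/- Let $X$ be a real or complex Banach space and let $A : D(A)\to X$ be the infinitesimal generator of a $C^0$-semigroup $(e^{At})_{t\ge 0}$ of bounded linear operators on $X$. Let $f_1,\dots,f_m:\mathbb{R}_0^+\times X\to X$ be continuous maps, each of which satisfies the following two assumptions. (A1) For every bounded set $C\subset X$ there exists $L\in L^\infty_{\rm loc}(\mathbb{R}_0^+,\mathbb{R}_0^+)$ such that $\|f_i(t,\xi)-f_i(t,\eta)\|\le L(t)\,\|\xi-\eta\|$ for all $\xi,\eta\in C$ and all $t\ge 0$. (A2) There exist $\alpha,\beta\in L^\infty_{\rm loc}(\mathbb{R}_0^+,\mathbb{R}_0^+)$ such that $\|f_i(t,\xi)\|\le\alpha(t)\|\xi\|+\beta(t)$ for all $\xi\in X$ and all $t\ge 0$. Let $\xi_0\in X$ and consider the control system $$\dot x(t)=Ax(t)+\sum_{i=1}^m u_i(t)f_i(t,x(t)),\qquad x(0)=\xi_0,\qquad u_i\in L^1_{\rm loc}([0,\infty),\mathbb{R}).$$ For $T\ge 0$ and $u=(u_1,\dots,u_m)\in L^1([0,T],\mathbb{R}^m)$, a mild solution on $[0,T]$ is a continuous map $x:[0,T]\to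 X$ with $$x(t)=e^{At}\xi_0+\sum_{i=1}^m\int_0^t e^{A(t-s)}u_i(s)f_i(s,x(s))\,\mathrm{d}s\qquad\text{for all } t\in[0,T].$$ The reachable set $\mathcal{R}^1(\xi_0)$ is the set of all values $x(t)$, where $T\ge 0$, $t\in[0,T]$, and $x$ is a mild solution on $[0,T]$ for some control $u\in L^1([0,T],\mathbb{R}^m)$. Then $\mathcal{R}^1(\xi_0)$ is a countable union of relatively compact subsets of $X$. Moreover, if $X$ is infinite-dimensional, then $\mathcal{R}^1(\xi_0)$ has no interior points. -/

import Mathlib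

open Set Filter Topology MeasureTheory

noncomputable section SemilinearControl

/-- `S t`, `t ≥ 0`, is a `C⁰`-semigroup (strongly continuous one-parameter semigroup) of bounded
linear operators on `X`. The time parameter is a real number, but only the values of `S` at
`t ≥ 0` matter. -/
structure IsC0Semigroup {𝕜 X : Type*} [RCLike 𝕜] [NormedAddCommGroup X] [NormedSpace 𝕜 X]
    (S : ℝ → X →L[𝕜] X) : Prop where
  zero : S 0 = ContinuousLinearMap.id 𝕜 X
  add : ∀ s t : ℝ, 0 ≤ s → 0 ≤ t → S (s + t) = (S s).comp (S t)
  continuousOn : ∀ x : X, ContinuousOn (fun t : ℝ => S t x) (Ici 0)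

/-- The (possibly unbounded) operator `A : D(A) → X` is the infinitesimal generator of `S`:
`x ∈ D(A)` and `A x = y` if and only if `(S h x - x) / h → y` as `h ↓ 0`. -/
def IsInfinitesimalGenerator {𝕜 X : Type*} [RCLike 𝕜] [NormedAddCommGroup X] [NormedSpace 𝕜 X]
    [NormedSpace ℝ X] (A : X →ₗ.[𝕜] X) (S : ℝ → X →L[𝕜] X) : Prop :=
  ∀ x y : X, (x, y) ∈ A.graph ↔
    Tendsto (fun h : ℝ => h⁻¹ • (S h x - x)) (𝓝[>] 0) (𝓝 y)

/-- `L ∈ L^∞_loc(ℝ₀⁺, ℝ₀⁺)`: nonnegative, measurable, and essentially bounded on every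
interval `[0, T]`. -/
def MemLinftyLocNonneg (L : ℝ → ℝ) : Prop :=
  (∀ t, 0 ≤ t → 0 ≤ L t) ∧ ∀ T, 0 ≤ T → MemLp L ⊤ (volume.restrict (Icc 0 T))

/-- `f : ℝ₀⁺ × X → X` is Lipschitz in the second variable on bounded sets, with
`L^∞_loc`-Lipschitz rate. -/
def LipschitzOnBoundedSets {X : Type*} [NormedAddCommGroup X] (f : ℝ → X → X) : Prop :=
  ∀ C : Set X, Bornology.IsBounded C → ∃ L : ℝ → ℝ, MemLinftyLocNonneg L ∧
    ∀ ξ ∈ C, ∀ η ∈ C, ∀ t, 0 ≤ t → ‖f t ξ - f t η‖ ≤ L t * ‖ξ - η‖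

/-- `f : ℝ₀⁺ × X → X` is linearly bounded, with `L^∞_loc` coefficients. -/
def LinearlyBounded {X : Type*} [NormedAddCommGroup X] (f : ℝ → X → X) : Prop :=
  ∃ α β : ℝ → ℝ, MemLinftyLocNonneg α ∧ MemLinftyLocNonneg β ∧
    ∀ (ξ : X) (t : ℝ), 0 ≤ t → ‖f t ξ‖ ≤ α t * ‖ξ‖ + β t

/-- `x` is a mild solution on `[0, T]` of
`x'(t) = A x(t) + ∑ i, u i t • f i t (x t)`, `x 0 = ξ₀`, where `A` generates the semigroup `S`:
`x` is continuous on `[0, T]` and satisfies the variation-of-constants formula there. -/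
structure IsMildSolution {𝕜 X : Type*} [RCLike 𝕜] [NormedAddCommGroup X] [NormedSpace 𝕜 X]
    [NormedSpace ℝ X] {m : ℕ} (S : ℝ → X →L[𝕜] X) (f : Fin m → ℝ → X → X) (ξ₀ : X)
    (u : Fin m → ℝ → ℝ) (T : ℝ) (x : ℝ → X) : Prop where
  continuousOn : ContinuousOn x (Icc 0 T)
  integrable : ∀ t ∈ Icc 0 T, ∀ i,
    IntervalIntegrable (fun s => S (t - s) (u i s • f i s (x s))) volume 0 t
  eq : ∀ t ∈ Icc 0 T,
    x t = S t ξ₀ + ∑ i, ∫ s in (0 : ℝ)..t, S (t - s) (u i s • f i s (x s))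

/-- The set of states reachable from `ξ₀` up to time `T` with controls
`u ∈ L¹([0, T], ℝ^m)`. -/
def reachableSetUpTo {𝕜 X : Type*} [RCLike 𝕜] [NormedAddCommGroup X] [NormedSpace 𝕜 X]
    [NormedSpace ℝ X] {m : ℕ} (S : ℝ → X →L[𝕜] X) (f : Fin m → ℝ → X → X) (ξ₀ : X)
    (T : ℝ) : Set X :=
  {η | ∃ (u : Fin m → ℝ → ℝ) (x : ℝ → X), (∀ i, IntegrableOn (u i) (Icc 0 T)) ∧
    IsMildSolution S f ξ₀ u T x ∧ ∃ t ∈ Icc 0 T, x t = η}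

/-- The reachable set `R¹(ξ₀)` under `L¹` controls. Since a control in `L¹([0, T])` extends by
zero to `L¹_loc([0, ∞))`, these are the states reachable with `L¹_loc` controls. -/
def reachableSet {𝕜 X : Type*} [RCLike 𝕜] [NormedAddCommGroup X] [NormedSpace 𝕜 X]
    [NormedSpace ℝ X] {m : ℕ} (S : ℝ → X →L[𝕜] X) (f : Fin m → ℝ → X → X) (ξ₀ : X) : Set X :=
  ⋃ T ∈ Ici (0 : ℝ), reachableSetUpTo S f ξ₀ T

end SemilinearControl

/-! Cut the reachable set into slices `massReachableSet S f ξ₀ n n`, bounding both the time and the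
L¹ mass of the control. Each slice is totally bounded, by induction on the mass in steps of a fixed
small `δ`. Cutting off a final piece of control of mass at most `δ` writes a state as `S τ y + δ •
d` (`IsMildSolution.exists_step`), where `y` is `ξ₀` or lies in the previous slice and `d` lies in a
closed convex symmetric set containing the integrands.

If the slice is within `r` of a compact set, the integrands are within `M * L * r` of another one.
Since `δ * (M * L) ≤ 1 / 2`, the slice is then within `r / 2` of a compact set, and iterating gives
total boundedness. The absence of interior points follows from Baire and Riesz. -/

/-! ### Uniform bounds on compact time intervals. -/

theorem IsC0Semigroup.exists_norm_le {𝕜 X : Type*} [RCLike 𝕜] [NormedAddCommGroup X]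
    [NormedSpace 𝕜 X] [CompleteSpace X] {S : ℝ → X →L[𝕜] X} (hS : IsC0Semigroup S) (N : ℝ) :
    ∃ M : ℝ, 0 ≤ M ∧ ∀ τ ∈ Icc 0 N, ‖S τ‖ ≤ M := by
  obtain ⟨C, hC⟩ := banach_steinhaus (g := fun τ : Icc (0 : ℝ) N => S τ) (by
    intro x
    obtain ⟨C, hC⟩ := isCompact_Icc.exists_bound_of_continuousOn
      ((hS.continuousOn x).mono (Icc_subset_Ici_self : Icc (0 : ℝ) N ⊆ Ici 0))
    exact ⟨C, fun τ => hC τ τ.2⟩)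
  exact ⟨max C 0, le_max_right _ _, fun τ hτ => (hC ⟨τ, hτ⟩).trans (le_max_left _ _)⟩

/-- Strong continuity and a uniform operator bound make `(τ, x) ↦ S τ x` jointly continuous. -/
theorem IsC0Semigroup.isCompact_image {𝕜 X : Type*} [RCLike 𝕜] [NormedAddCommGroup X]
    [NormedSpace 𝕜 X] [CompleteSpace X] {S : ℝ → X →L[𝕜] X} (hS : IsC0Semigroup S) (N : ℝ)
    {K : Set X} (hK : IsCompact K) :
    IsCompact ((fun p : ℝ × X => S p.1 p.2) '' (Icc 0 N ×ˢ K)) := by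
  obtain ⟨M, hM, hSM⟩ := hS.exists_norm_le N
  refine (isCompact_Icc.prod hK).image_of_continuousOn ?_
  refine continuousOn_prod_of_continuousOn_lipschitzOnWith' _ ⟨M, hM⟩ (fun τ hτ => ?_)
    (fun x _ => (hS.continuousOn x).mono Icc_subset_Ici_self)
  exact ((S τ).lipschitz.weaken (hSM τ hτ)).lipschitzOnWith

theorem MemLinftyLocNonneg.exists_ae_le {L : ℝ → ℝ} (hL : MemLinftyLocNonneg L) {N : ℝ}
    (hN : 0 ≤ N) : ∃ C : ℝ, 0 ≤ C ∧ ∀ᵐ t, t ∈ Icc 0 N → L t ≤ C := by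
  have hfin : eLpNormEssSup L (volume.restrict (Icc 0 N)) < ⊤ := by
    simpa using (hL.2 N hN).eLpNorm_lt_top
  have h := (ae_restrict_iff' measurableSet_Icc).1
    (ae_le_eLpNormEssSup (f := L) (μ := volume.restrict (Icc 0 N)))
  refine ⟨(eLpNormEssSup L (volume.restrict (Icc 0 N))).toReal, ENNReal.toReal_nonneg,
    h.mono fun t ht htN => (le_abs_self _).trans ?_⟩
  simpa using ENNReal.toReal_mono hfin.ne (ht htN)

theorem exists_linear_bound {X : Type*} [NormedAddCommGroup X] {m : ℕ} {f : Fin m → ℝ → X → X}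
    (hf : ∀ i, LinearlyBounded (f i)) {N : ℝ} (hN : 0 ≤ N) :
    ∃ a b : ℝ, 0 ≤ a ∧ 0 ≤ b ∧
      ∀ i, ∀ᵐ t, t ∈ Icc 0 N → ∀ ξ, ‖f i t ξ‖ ≤ a * ‖ξ‖ + b := by
  choose α β hα hβ h using hf
  choose a ha0 ha using fun i => (hα i).exists_ae_le hN
  choose b hb0 hb using fun i => (hβ i).exists_ae_le hN
  refine ⟨∑ i, a i, ∑ i, b i, Finset.sum_nonneg fun i _ => ha0 i,
    Finset.sum_nonneg fun i _ => hb0 i, fun i => ?_⟩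
  filter_upwards [ha i, hb i] with t hat hbt ht ξ
  have h1 := hat ht
  have h2 := hbt ht
  have h3 : a i ≤ ∑ i, a i := Finset.single_le_sum (fun i _ => ha0 i) (Finset.mem_univ i)
  have h4 : b i ≤ ∑ i, b i := Finset.single_le_sum (fun i _ => hb0 i) (Finset.mem_univ i)
  refine (h i ξ t ht.1).trans ?_
  gcongr <;> linarith

theorem exists_lipschitz_bound {X : Type*} [NormedAddCommGroup X] {m : ℕ}
    {f : Fin m → ℝ → X → X} (hf : ∀ i, LipschitzOnBoundedSets (f i)) {C : Set X}
    (hC : Bornology.IsBounded C) {N : ℝ} (hN : 0 ≤ N) :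
    ∃ L : ℝ, 0 ≤ L ∧ ∀ i, ∀ᵐ t, t ∈ Icc 0 N →
      ∀ ξ ∈ C, ∀ η ∈ C, ‖f i t ξ - f i t η‖ ≤ L * ‖ξ - η‖ := by
  choose L hL h using fun i => hf i C hC
  choose a ha0 ha using fun i => (hL i).exists_ae_le hN
  refine ⟨∑ i, a i, Finset.sum_nonneg fun i _ => ha0 i, fun i => ?_⟩
  filter_upwards [ha i] with t hat ht ξ hξ η hη
  have h1 := hat ht
  have h3 : a i ≤ ∑ i, a i := Finset.single_le_sum (fun i _ => ha0 i) (Finset.mem_univ i)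
  refine (h i ξ hξ η hη t ht.1).trans ?_
  gcongr
  linarith

/-! ### Splitting off a piece of control of small mass. -/

/-- A weighted vector integral lies in the total weight times any closed, convex, symmetric set
containing the integrands. -/
theorem exists_sum_integral_eq_smul {X : Type*} [NormedAddCommGroup X] [NormedSpace ℝ X]
    [CompleteSpace X] {m : ℕ} {D : Set X} (hD : Convex ℝ D) (hDc : IsClosed D)
    (hDs : ∀ z ∈ D, -z ∈ D) (hD0 : (0 : X) ∈ D) {s t δ : ℝ} (hst : s ≤ t) (hδ : 0 < δ)
    {u : Fin m → ℝ → ℝ} {g : Fin m → ℝ → X}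
    (hu : ∀ i, IntervalIntegrable (u i) volume s t)
    (hug : ∀ i, IntervalIntegrable (fun σ => u i σ • g i σ) volume s t)
    (hg : ∀ i, ∀ᵐ σ, σ ∈ Ioc s t → g i σ ∈ D)
    (hmass : ∑ i, ∫ σ in s..t, |u i σ| ≤ δ) :
    ∃ d ∈ D, ∑ i, ∫ σ in s..t, u i σ • g i σ = δ • d := by
  refine ⟨δ⁻¹ • ∑ i, ∫ σ in s..t, u i σ • g i σ, ?_, by rw [smul_inv_smul₀ hδ.ne']⟩
  by_contra hx
  -- Symmetry of `D` upgrades `ℓ < c` to `|ℓ| ≤ c`, so weights of either sign are allowed; `0 ∈ D`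
  -- gives `c > 0`, so mass below `δ` suffices.
  obtain ⟨ℓ, c, hc, hlt⟩ := geometric_hahn_banach_closed_point hD hDc hx
  have hc0 : 0 < c := by simpa using hc 0 hD0
  have habs : ∀ z ∈ D, |ℓ z| ≤ c := fun z hz =>
    abs_le.2 ⟨by have := hc _ (hDs z hz); rw [map_neg] at this; linarith, (hc z hz).le⟩
  have key : ∀ i, ℓ (∫ σ in s..t, u i σ • g i σ) ≤ c * ∫ σ in s..t, |u i σ| := by
    intro i
    rw [← ℓ.intervalIntegral_comp_comm (hug i), ← intervalIntegral.integral_const_mul]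
    refine (Real.le_norm_self _).trans
      (intervalIntegral.norm_integral_le_of_norm_le hst ?_ ((hu i).abs.const_mul c))
    filter_upwards [hg i] with σ hσ hσt
    rw [map_smul, smul_eq_mul, Real.norm_eq_abs, abs_mul, mul_comm]
    exact mul_le_mul_of_nonneg_right (habs _ (hσ hσt)) (abs_nonneg _)
  rw [map_smul, map_sum, smul_eq_mul] at hlt
  have h1 : ∑ i, ℓ (∫ σ in s..t, u i σ • g i σ) ≤ c * δ := by
    refine (Finset.sum_le_sum fun i _ => key i).trans ?_
    rw [← Finset.mul_sum]
    exact mul_le_mul_of_nonneg_left hmass hc0.le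
  have h2 : δ⁻¹ * ∑ i, ℓ (∫ σ in s..t, u i σ • g i σ) ≤ δ⁻¹ * (c * δ) :=
    mul_le_mul_of_nonneg_left h1 (inv_nonneg.2 hδ.le)
  have h3 : δ⁻¹ * (c * δ) = c := by field_simp
  linarith

theorem IsMildSolution.eq_restart {𝕜 X : Type*} [RCLike 𝕜] [NormedAddCommGroup X]
    [NormedSpace 𝕜 X] [NormedSpace ℝ X] [IsScalarTower ℝ 𝕜 X] [CompleteSpace X] {m : ℕ}
    {S : ℝ → X →L[𝕜] X} (hS : IsC0Semigroup S) {f : Fin m → ℝ → X → X} {ξ₀ : X}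
    {u : Fin m → ℝ → ℝ} {T : ℝ} {x : ℝ → X} (hx : IsMildSolution S f ξ₀ u T x) {s t : ℝ}
    (hs : 0 ≤ s) (hst : s ≤ t) (ht : t ≤ T) :
    x t = S (t - s) (x s) + ∑ i, ∫ σ in s..t, u i σ • S (t - σ) (f i σ (x σ)) := by
  have hsT : s ∈ Icc 0 T := ⟨hs, hst.trans ht⟩
  have htT : t ∈ Icc 0 T := ⟨hs.trans hst, ht⟩
  have hadd : ∀ r ∈ Icc 0 s, ∀ y, S (t - r) y = S (t - s) (S (s - r) y) := by
    intro r hr y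
    rw [← ContinuousLinearMap.comp_apply, ← hS.add _ _ (sub_nonneg.2 hst) (sub_nonneg.2 hr.2)]
    congr 2
    ring
  have h0 : S t ξ₀ = S (t - s) (S s ξ₀) := by
    simpa using hadd 0 ⟨le_rfl, hs⟩ ξ₀
  rw [hx.eq t htT, hx.eq s hsT, map_add, ← h0, add_assoc, map_sum, ← Finset.sum_add_distrib]
  congr 1
  refine Finset.sum_congr rfl fun i _ => ?_
  have hint := hx.integrable t htT i
  have hsmem : s ∈ uIcc 0 t := by rw [uIcc_of_le htT.1]; exact ⟨hs, hst⟩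
  rw [← intervalIntegral.integral_add_adjacent_intervals
    (hint.mono_set (uIcc_subset_uIcc_left hsmem)) (hint.mono_set (uIcc_subset_uIcc_right hsmem)),
    ← (S (t - s)).intervalIntegral_comp_comm (hx.integrable s hsT i)]
  congr 1
  · refine intervalIntegral.integral_congr fun r hr => ?_
    rw [uIcc_of_le hs] at hr
    exact hadd r hr _
  · exact intervalIntegral.integral_congr fun r _ => (S (t - r)).map_smul_of_tower _ _

theorem IsMildSolution.intervalIntegrable {𝕜 X : Type*} [RCLike 𝕜] [NormedAddCommGroup X]
    [NormedSpace 𝕜 X] [NormedSpace ℝ X] [IsScalarTower ℝ 𝕜 X] {m : ℕ}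
    {S : ℝ → X →L[𝕜] X} {f : Fin m → ℝ → X → X} {ξ₀ : X}
    {u : Fin m → ℝ → ℝ} {T : ℝ} {x : ℝ → X} (hx : IsMildSolution S f ξ₀ u T x) {s t : ℝ}
    (hs : 0 ≤ s) (hst : s ≤ t) (ht : t ≤ T) (i : Fin m) :
    IntervalIntegrable (fun σ => u i σ • S (t - σ) (f i σ (x σ))) volume s t := by
  have hsmem : s ∈ uIcc 0 t := by rw [uIcc_of_le (hs.trans hst)]; exact ⟨hs, hst⟩
  refine ((hx.integrable t ⟨hs.trans hst, ht⟩ i).mono_set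
    (uIcc_subset_uIcc_right hsmem)).congr fun r _ => ?_
  exact (S (t - r)).map_smul_of_tower _ _

/-- States reached before time `N` while the accumulated `L¹` mass of the control is at most
`c`. -/
def massReachableSet {𝕜 X : Type*} [RCLike 𝕜] [NormedAddCommGroup X] [NormedSpace 𝕜 X]
    [NormedSpace ℝ X] {m : ℕ} (S : ℝ → X →L[𝕜] X) (f : Fin m → ℝ → X → X) (ξ₀ : X)
    (N c : ℝ) : Set X :=
  {η | ∃ (T : ℝ) (u : Fin m → ℝ → ℝ) (x : ℝ → X), T ≤ N ∧ (∀ i, IntegrableOn (u i) (Icc 0 T)) ∧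
    IsMildSolution S f ξ₀ u T x ∧
    ∃ t ∈ Icc 0 T, ∑ i, ∫ σ in (0 : ℝ)..t, |u i σ| ≤ c ∧ x t = η}

theorem intervalIntegrable_of_integrableOn_Icc {u : ℝ → ℝ} {T s t : ℝ} (hu : IntegrableOn u (Icc 0 T))
    (hs : 0 ≤ s) (hst : s ≤ t) (ht : t ≤ T) : IntervalIntegrable u volume s t := by
  refine (hu.mono_set ?_).intervalIntegrable
  rw [uIcc_of_le hst]
  exact Icc_subset_Icc hs ht

/-- The control can be cut so that the last piece has mass at most `δ`. -/
theorem exists_split_mass {m : ℕ} {u : Fin m → ℝ → ℝ} {T t c δ : ℝ} (hδ : 0 ≤ δ)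
    (hu : ∀ i, IntegrableOn (u i) (Icc 0 T)) (ht : t ∈ Icc 0 T)
    (hmass : ∑ i, ∫ σ in (0 : ℝ)..t, |u i σ| ≤ c + δ) :
    ∃ s ∈ Icc 0 t, (s = 0 ∨ ∑ i, ∫ σ in (0 : ℝ)..s, |u i σ| ≤ c) ∧
      ∑ i, ∫ σ in s..t, |u i σ| ≤ δ := by
  set U : ℝ → ℝ := fun r => ∑ i, ∫ σ in (0 : ℝ)..r, |u i σ| with hU
  have hU0 : U 0 = 0 := by simp [hU]
  have hsub : ∀ s ∈ Icc 0 t, ∑ i, ∫ σ in s..t, |u i σ| = U t - U s := by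
    intro s hs
    simp only [hU, ← Finset.sum_sub_distrib]
    refine Finset.sum_congr rfl fun i _ => ?_
    rw [intervalIntegral.integral_interval_sub_left]
    · exact (intervalIntegrable_of_integrableOn_Icc (hu i) le_rfl ht.1 ht.2).abs
    · exact (intervalIntegrable_of_integrableOn_Icc (hu i) le_rfl hs.1 (hs.2.trans ht.2)).abs
  have hcont : ContinuousOn U (Icc 0 t) := by
    refine continuousOn_finsetSum _ fun i _ => ?_
    rw [← uIcc_of_le ht.1]
    refine intervalIntegral.continuousOn_primitive_interval ?_
    rw [uIcc_of_le ht.1]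
    exact ((hu i).mono_set (Icc_subset_Icc le_rfl ht.2)).abs
  rcases lt_or_ge c 0 with hc | hc
  -- No state has negative mass, so the last piece is the whole control, started from `ξ₀`.
  · refine ⟨0, ⟨le_rfl, ht.1⟩, Or.inl rfl, ?_⟩
    change U t ≤ δ
    change U t ≤ c + δ at hmass
    linarith
  rcases le_total (U t) c with h | h
  · refine ⟨t, ⟨ht.1, le_rfl⟩, Or.inr h, by simpa using hδ⟩
  · obtain ⟨s, hs, hsc⟩ := intermediate_value_Icc ht.1 hcont ⟨hU0.le.trans hc, h⟩
    refine ⟨s, hs, Or.inr hsc.le, ?_⟩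
    rw [hsub s hs, hsc]
    change U t ≤ c + δ at hmass
    linarith

theorem step_induction {P : ℝ → Prop} {δ : ℝ} (hδ : 0 < δ) (hneg : ∀ c < 0, P c)
    (hstep : ∀ c, P c → P (c + δ)) (c : ℝ) : P c := by
  have h : ∀ n : ℕ, ∀ c, c < n * δ → P c := by
    intro n
    induction n with
    | zero => intro c hc; exact hneg c (by simpa using hc)
    | succ n ih =>
      intro c hc
      have := hstep (c - δ) (ih _ (by push_cast at hc; linarith))
      simpa using this
  obtain ⟨n, hn⟩ := exists_nat_gt (c / δ)
  exact h n c ((div_lt_iff₀ hδ).1 hn)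

section

variable {𝕜 X : Type*} [RCLike 𝕜] [NormedAddCommGroup X]
    [NormedSpace 𝕜 X] [NormedSpace ℝ X] {m : ℕ}
    {S : ℝ → X →L[𝕜] X} {f : Fin m → ℝ → X → X} {ξ₀ : X} {N : ℝ}

theorem massReachableSet_of_neg {c : ℝ} (hc : c < 0) : massReachableSet S f ξ₀ N c = ∅ := by
  refine eq_empty_of_forall_notMem ?_
  rintro η ⟨T, u, x, -, -, -, t, ht, hm, -⟩
  have : 0 ≤ ∑ i, ∫ σ in (0 : ℝ)..t, |u i σ| := Finset.sum_nonneg fun i _ =>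
    intervalIntegral.integral_nonneg ht.1 fun _ _ => abs_nonneg _
  linarith

theorem IsMildSolution.apply_mem_massReachableSet {u : Fin m → ℝ → ℝ} {T c : ℝ} {x : ℝ → X}
    (hx : IsMildSolution S f ξ₀ u T x) (hTN : T ≤ N) (hu : ∀ i, IntegrableOn (u i) (Icc 0 T))
    {t σ : ℝ} (ht : t ≤ T) (hσ : σ ∈ Icc 0 t)
    (hm : ∑ i, ∫ σ in (0 : ℝ)..t, |u i σ| ≤ c) : x σ ∈ massReachableSet S f ξ₀ N c := by
  refine ⟨T, u, x, hTN, hu, hx, σ, ⟨hσ.1, hσ.2.trans ht⟩, le_trans ?_ hm, rfl⟩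
  refine Finset.sum_le_sum fun i _ => ?_
  refine intervalIntegral.integral_mono_interval le_rfl hσ.1 hσ.2
    (Eventually.of_forall fun _ => abs_nonneg _)
    (intervalIntegrable_of_integrableOn_Icc (hu i) le_rfl (hσ.1.trans hσ.2) ht).abs

/-- One step of the induction on the control mass: the state is the image under the semigroup of
a state with smaller mass, plus a small multiple of a point of a closed convex symmetric set
containing the values of the vector fields along the trajectory. -/
theorem IsMildSolution.exists_step [IsScalarTower ℝ 𝕜 X] [CompleteSpace X]
    (hS : IsC0Semigroup S) {u : Fin m → ℝ → ℝ} {T c δ : ℝ}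
    {x : ℝ → X} (hx : IsMildSolution S f ξ₀ u T x) (hTN : T ≤ N)
    (hu : ∀ i, IntegrableOn (u i) (Icc 0 T)) {t : ℝ} (ht : t ∈ Icc 0 T) (hδ : 0 < δ)
    (hm : ∑ i, ∫ σ in (0 : ℝ)..t, |u i σ| ≤ c + δ)
    {D : Set X} (hD : Convex ℝ D) (hDc : IsClosed D)
    (hDs : ∀ z ∈ D, -z ∈ D) (hD0 : (0 : X) ∈ D)
    (hg : ∀ i, ∀ᵐ σ, σ ∈ Icc 0 t → S (t - σ) (f i σ (x σ)) ∈ D) :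
    ∃ τ ∈ Icc 0 N, ∃ y ∈ insert ξ₀ (massReachableSet S f ξ₀ N c), ∃ d ∈ D,
      x t = S τ y + δ • d := by
  obtain ⟨s, hs, hsc, hsδ⟩ := exists_split_mass hδ.le hu ht hm
  obtain ⟨d, hd, hsum⟩ := exists_sum_integral_eq_smul hD hDc hDs hD0 hs.2 hδ
    (fun i => intervalIntegrable_of_integrableOn_Icc (hu i) hs.1 hs.2 ht.2)
    (hx.intervalIntegrable hs.1 hs.2 ht.2)
    (fun i => (hg i).mono fun σ h hσ => h ⟨hs.1.trans hσ.1.le, hσ.2⟩) hsδ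
  have hxs : x s ∈ insert ξ₀ (massReachableSet S f ξ₀ N c) := by
    rcases hsc with rfl | hsc
    · left
      rw [hx.eq 0 ⟨le_rfl, ht.1.trans ht.2⟩]
      simp [hS.zero]
    · exact Or.inr (hx.apply_mem_massReachableSet hTN hu (hs.2.trans ht.2) ⟨hs.1, le_rfl⟩ hsc)
  refine ⟨t - s, ⟨by linarith [hs.2], by linarith [hs.1, ht.2]⟩, x s, hxs, d, hd, ?_⟩
  rw [hx.eq_restart hS hs.1 hs.2 ht.2, hsum]

end
section

variable {𝕜 X : Type*} [RCLike 𝕜] [NormedAddCommGroup X]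
    [NormedSpace 𝕜 X] [NormedSpace ℝ X] [IsScalarTower ℝ 𝕜 X] [CompleteSpace X] {m : ℕ}
    {S : ℝ → X →L[𝕜] X} {f : Fin m → ℝ → X → X}

/-! ### Boundedness and total boundedness of the slices. -/

theorem exists_norm_le_of_mem_massReachableSet (hS : IsC0Semigroup S) (hf : ∀ i, LinearlyBounded (f i))
    (ξ₀ : X) {N : ℝ} (hN : 0 ≤ N) (c : ℝ) :
    ∃ B, 0 ≤ B ∧ ∀ η ∈ massReachableSet S f ξ₀ N c, ‖η‖ ≤ B := by
  obtain ⟨M, hM, hSM⟩ := hS.exists_norm_le N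
  obtain ⟨a, b, ha, hb, hab⟩ := exists_linear_bound hf hN
  have hMa : 0 ≤ M * a := mul_nonneg hM ha
  set δ : ℝ := 1 / (2 * (M * a + 1)) with hδdef
  have hδ : 0 < δ := by positivity
  have hδM : δ * (M * a) ≤ 1 / 2 := by
    rw [hδdef, div_mul_eq_mul_div, div_le_div_iff₀ (by positivity) (by positivity)]
    linarith
  refine step_induction
    (P := fun c => ∃ B, 0 ≤ B ∧ ∀ η ∈ massReachableSet S f ξ₀ N c, ‖η‖ ≤ B) hδ
    (fun c hc => ⟨0, le_rfl, by simp [massReachableSet_of_neg hc]⟩) ?_ c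
  rintro c ⟨B, hB, hBc⟩
  refine ⟨2 * (M * (B + ‖ξ₀‖) + δ * (M * b)), by positivity, ?_⟩
  rintro η ⟨T, u, x, hTN, hu, hx, t, ht, hm, rfl⟩
  -- In place of Gronwall: at a time `r` where the norm is maximal, the growth term is at most `‖x
  -- r‖ / 2` and can be absorbed.
  obtain ⟨r, hr, hmax⟩ := isCompact_Icc.exists_isMaxOn (nonempty_Icc.2 ht.1)
    (hx.continuousOn.mono (Icc_subset_Icc le_rfl ht.2)).norm
  have hmr : ∑ i, ∫ σ in (0 : ℝ)..r, |u i σ| ≤ c + δ := by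
    refine le_trans (Finset.sum_le_sum fun i _ => ?_) hm
    exact intervalIntegral.integral_mono_interval le_rfl hr.1 hr.2
      (Eventually.of_forall fun _ => abs_nonneg _)
      (intervalIntegrable_of_integrableOn_Icc (hu i) le_rfl ht.1 ht.2).abs
  have hle : ∀ σ ∈ Icc 0 t, ‖x σ‖ ≤ ‖x r‖ := fun σ hσ => hmax hσ
  have hrT : r ∈ Icc 0 T := ⟨hr.1, hr.2.trans ht.2⟩
  set ρ : ℝ := M * (a * ‖x r‖ + b) with hρ
  have hρ0 : 0 ≤ ρ := by positivity
  obtain ⟨τ, hτ, y, hy, d, hd, hxr⟩ := hx.exists_step hS hTN hu hrT hδ hmr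
    (D := Metric.closedBall 0 ρ) (convex_closedBall _ _)
    Metric.isClosed_closedBall (by simp) (by simpa using hρ0) (by
      intro i
      filter_upwards [hab i] with σ hσ hσr
      rw [mem_closedBall_zero_iff]
      refine ((S (r - σ)).le_of_opNorm_le
        (hSM _ ⟨by linarith [hσr.2], by linarith [hσr.1, hrT.2]⟩) _).trans ?_
      have h1 := hσ ⟨hσr.1, by linarith [hσr.2, hrT.2]⟩ (x σ)
      have h2 := hle σ ⟨hσr.1, hσr.2.trans hr.2⟩
      rw [hρ]
      gcongr
      exact h1.trans (by gcongr))
  have hyB : ‖y‖ ≤ B + ‖ξ₀‖ := by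
    rcases hy with rfl | hy
    · linarith
    · linarith [hBc y hy, norm_nonneg ξ₀]
  have h1 : ‖x r‖ ≤ M * (B + ‖ξ₀‖) + δ * ρ := by
    nth_rw 1 [hxr]
    refine (norm_add_le _ _).trans (add_le_add ?_ ?_)
    · exact ((S τ).le_of_opNorm_le (hSM τ hτ) y).trans (by gcongr)
    · rw [norm_smul, Real.norm_of_nonneg hδ.le]
      exact mul_le_mul_of_nonneg_left (mem_closedBall_zero_iff.1 hd) hδ.le
  have h2 : δ * ρ = δ * (M * a) * ‖x r‖ + δ * (M * b) := by rw [hρ]; ring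
  have h3 : δ * (M * a) * ‖x r‖ ≤ 1 / 2 * ‖x r‖ := by gcongr
  have h4 := hle t ⟨ht.1, le_rfl⟩
  linarith

open scoped Pointwise in
theorem exists_isCompact_convex_symmetric {X : Type*} [NormedAddCommGroup X] [NormedSpace ℝ X]
    [CompleteSpace X] {G : Set X} (hG : IsCompact G) :
    ∃ Q : Set X, IsCompact Q ∧ Convex ℝ Q ∧ (∀ z ∈ Q, -z ∈ Q) ∧ (0 : X) ∈ Q ∧ G ⊆ Q := by
  set G' : Set X := insert 0 (G ∪ -G) with hG'
  have hG'c : IsCompact G' := (hG.union hG.neg).insert 0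
  have hneg : -G' = G' := by simp [hG', union_comm]
  refine ⟨closure (convexHull ℝ G'), ?_, (convex_convexHull ℝ _).closure, ?_, ?_, ?_⟩
  · exact (hG'c.totallyBounded.convexHull).closure.isCompact_of_isClosed isClosed_closure
  · intro z hz
    refine map_mem_closure continuous_neg hz fun y hy => ?_
    rw [← hneg, convexHull_neg]
    simpa using hy
  · exact subset_closure (subset_convexHull ℝ _ (mem_insert _ _))
  · exact fun z hz => subset_closure (subset_convexHull ℝ _ (Or.inr (Or.inl hz)))

open scoped Pointwise in
theorem totallyBounded_massReachableSet (hS : IsC0Semigroup S)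
    (hfc : ∀ i, ContinuousOn (fun p : ℝ × X => f i p.1 p.2) (Ici 0 ×ˢ univ))
    (hLip : ∀ i, LipschitzOnBoundedSets (f i)) (hf : ∀ i, LinearlyBounded (f i))
    (ξ₀ : X) {N : ℝ} (hN : 0 ≤ N) (c : ℝ) :
    TotallyBounded (massReachableSet S f ξ₀ N c) := by
  obtain ⟨M, hM, hSM⟩ := hS.exists_norm_le N
  obtain ⟨B, hB, hBc⟩ := exists_norm_le_of_mem_massReachableSet hS hf ξ₀ hN c
  -- Radius `2 * B` also covers approximating points at distance at most `B` from a state.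
  obtain ⟨L, hL, hLf⟩ := exists_lipschitz_bound hLip
    (Metric.isBounded_closedBall (x := (0 : X)) (r := 2 * B)) hN
  have hML : 0 ≤ M * L := mul_nonneg hM hL
  set δ : ℝ := 1 / (2 * (M * L + 1)) with hδdef
  have hδ : 0 < δ := by positivity
  have hδM : δ * (M * L) ≤ 1 / 2 := by
    rw [hδdef, div_mul_eq_mul_div, div_le_div_iff₀ (by positivity) (by positivity)]
    linarith
  -- The guard `c' ≤ c` keeps `B`, `L` and `δ` fixed throughout the induction.
  refine step_induction (P := fun c' => c' ≤ c → TotallyBounded (massReachableSet S f ξ₀ N c'))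
    hδ (fun c' hc _ => by rw [massReachableSet_of_neg hc]; exact totallyBounded_empty) ?_ c le_rfl
  intro c' ih hc'
  have hK : IsCompact (closure (insert ξ₀ (massReachableSet S f ξ₀ N c'))) :=
    ((ih (by linarith)).insert ξ₀).closure.isCompact_of_isClosed isClosed_closure
  have hBc' : ∀ η ∈ massReachableSet S f ξ₀ N (c' + δ), ‖η‖ ≤ B := by
    rintro η ⟨T, u, x, hTN, hu, hx, t, ht, hm, rfl⟩
    exact hBc _ ⟨T, u, x, hTN, hu, hx, t, ht, hm.trans hc', rfl⟩
  have halve : ∀ r, 0 ≤ r → r ≤ B →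
      (∃ F : Set X, IsCompact F ∧
        ∀ z ∈ massReachableSet S f ξ₀ N (c' + δ), ∃ y ∈ F, ‖z - y‖ ≤ r) →
      ∃ F : Set X, IsCompact F ∧
        ∀ z ∈ massReachableSet S f ξ₀ N (c' + δ), ∃ y ∈ F, ‖z - y‖ ≤ r / 2 := by
    rintro r hr hrB ⟨F, hF, hFr⟩
    have hfF : IsCompact (⋃ i, (fun p : ℝ × X => f i p.1 p.2) '' (Icc 0 N ×ˢ F)) :=
      isCompact_iUnion fun i => (isCompact_Icc.prod hF).image_of_continuousOn
        ((hfc i).mono (prod_mono Icc_subset_Ici_self (subset_univ _)))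
    obtain ⟨Q, hQ, hQconv, hQs, hQ0, hGQ⟩ :=
      exists_isCompact_convex_symmetric (hS.isCompact_image N hfF)
    refine ⟨_, (hS.isCompact_image N hK).add (hQ.smul δ), ?_⟩
    rintro z ⟨T, u, x, hTN, hu, hx, t, ht, hm, rfl⟩
    have hr' : 0 ≤ M * (L * r) := by positivity
    obtain ⟨τ, hτ, y, hy, d, hd, hxt⟩ := hx.exists_step hS hTN hu ht hδ hm
      -- `Q` absorbs the field values at the approximating points, the ball the Lipschitz error
      -- after applying the semigroup.
      (D := Q + Metric.closedBall 0 (M * (L * r))) (hQconv.add (convex_closedBall _ _))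
      (Metric.isClosed_closedBall.add_left_of_isCompact hQ)
      (by
        rintro _ ⟨q, hq, e, he, rfl⟩
        exact ⟨-q, hQs q hq, -e, by simpa using he, (neg_add _ _).symm⟩)
      ⟨0, hQ0, 0, by simpa using hr', add_zero _⟩ (by
        intro i
        filter_upwards [hLf i] with σ hσ hσt
        have hσN : σ ∈ Icc 0 N := ⟨hσt.1, by linarith [hσt.2, ht.2]⟩
        have hτN : t - σ ∈ Icc 0 N := ⟨by linarith [hσt.2], by linarith [hσt.1, ht.2]⟩
        have hxσ := hx.apply_mem_massReachableSet hTN hu ht.2 hσt hm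
        obtain ⟨y, hy, hxy⟩ := hFr _ hxσ
        have hxB := hBc' _ hxσ
        have hyB : ‖y‖ ≤ 2 * B := by
          have := norm_sub_norm_le y (x σ)
          rw [norm_sub_rev] at this
          linarith
        refine ⟨S (t - σ) (f i σ y), hGQ ⟨(t - σ, f i σ y), ⟨hτN, mem_iUnion.2
          ⟨i, (σ, y), ⟨hσN, hy⟩, rfl⟩⟩, rfl⟩, S (t - σ) (f i σ (x σ) - f i σ y), ?_, by simp⟩
        rw [mem_closedBall_zero_iff]
        refine ((S (t - σ)).le_of_opNorm_le (hSM _ hτN) _).trans ?_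
        gcongr
        refine (hσ hσN _ (mem_closedBall_zero_iff.2 (by linarith)) _
          (mem_closedBall_zero_iff.2 hyB)).trans ?_
        gcongr)
    obtain ⟨q, hq, e, he, rfl⟩ := hd
    refine ⟨S τ y + δ • q, ⟨S τ y, ⟨(τ, y), ⟨hτ, subset_closure hy⟩, rfl⟩, δ • q,
      ⟨q, hq, rfl⟩, rfl⟩, ?_⟩
    have h1 : x t - (S τ y + δ • q) = δ • e := by
      rw [hxt]
      simp only [smul_add]
      abel
    rw [h1, norm_smul, Real.norm_of_nonneg hδ.le]
    have h2 : ‖e‖ ≤ M * (L * r) := mem_closedBall_zero_iff.1 he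
    calc δ * ‖e‖ ≤ δ * (M * (L * r)) := by gcongr
      _ = δ * (M * L) * r := by ring
      _ ≤ 1 / 2 * r := by gcongr
      _ = r / 2 := by ring
  have hnet : ∀ n : ℕ, ∃ F : Set X, IsCompact F ∧
      ∀ z ∈ massReachableSet S f ξ₀ N (c' + δ), ∃ y ∈ F, ‖z - y‖ ≤ B / 2 ^ n := by
    intro n
    induction n with
    | zero => exact ⟨{0}, isCompact_singleton, fun z hz => ⟨0, rfl, by simpa using hBc' z hz⟩⟩
    | succ n ihn =>
      have := halve (B / 2 ^ n) (by positivity)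
        (div_le_self hB (one_le_pow₀ one_le_two)) ihn
      rwa [div_div, ← pow_succ] at this
  rw [Metric.totallyBounded_iff]
  intro ε hε
  obtain ⟨n, hn⟩ : ∃ n : ℕ, B / 2 ^ n < ε / 2 := by
    have h : Tendsto (fun n : ℕ => B / 2 ^ n) atTop (𝓝 0) :=
      tendsto_const_nhds.div_atTop (tendsto_pow_atTop_atTop_of_one_lt one_lt_two)
    exact (h.eventually (gt_mem_nhds (half_pos hε))).exists
  obtain ⟨F, hF, hFn⟩ := hnet n
  obtain ⟨t, ht, hFt⟩ := Metric.totallyBounded_iff.1 hF.totallyBounded (ε / 2) (half_pos hε)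
  refine ⟨t, ht, fun z hz => ?_⟩
  obtain ⟨y, hy, hzy⟩ := hFn z hz
  obtain ⟨p, hp, hyp⟩ := mem_iUnion₂.1 (hFt hy)
  refine mem_iUnion₂.2 ⟨p, hp, ?_⟩
  rw [Metric.mem_ball] at hyp ⊢
  have := dist_triangle z y p
  rw [dist_eq_norm z y] at this
  linarith

omit [IsScalarTower ℝ 𝕜 X] [CompleteSpace X] in
theorem reachableSet_eq_iUnion (S : ℝ → X →L[𝕜] X) (f : Fin m → ℝ → X → X) (ξ₀ : X) :
    reachableSet S f ξ₀ = ⋃ n : ℕ, massReachableSet S f ξ₀ n n := by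
  ext η
  simp only [reachableSet, mem_iUnion]
  constructor
  · rintro ⟨T, -, u, x, hu, hx, t, ht, rfl⟩
    obtain ⟨n, hn⟩ := exists_nat_ge (max T (∑ i, ∫ σ in (0 : ℝ)..t, |u i σ|))
    exact ⟨n, T, u, x, (le_max_left _ _).trans hn, hu, hx, t, ht, (le_max_right _ _).trans hn, rfl⟩
  · rintro ⟨n, T, u, x, -, hu, hx, t, ht, -, rfl⟩
    exact ⟨T, ht.1.trans ht.2, u, x, hu, hx, t, ht, rfl⟩

end

/-- By Riesz, a compact set in infinite dimension contains no ball, so each closure is nowhere dense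
and Baire applies. -/
theorem interior_iUnion_eq_empty_of_isCompact_closure (𝕜 : Type*) {X : Type*} [RCLike 𝕜]
    [NormedAddCommGroup X] [NormedSpace 𝕜 X] [CompleteSpace X] (hX : ¬ FiniteDimensional 𝕜 X)
    {K : ℕ → Set X} (hK : ∀ n, IsCompact (closure (K n))) : interior (⋃ n, K n) = ∅ := by
  have hdense : Dense (⋂ n, (closure (K n))ᶜ) := by
    refine dense_iInter_of_isOpen (fun n => isClosed_closure.isOpen_compl) fun n => ?_
    rw [← interior_eq_empty_iff_dense_compl]
    by_contra h
    obtain ⟨x, hx⟩ := nonempty_iff_ne_empty.2 h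
    obtain ⟨r, hr, hxr⟩ := Metric.nhds_basis_closedBall.mem_iff.1 (mem_interior_iff_mem_nhds.1 hx)
    exact hX (FiniteDimensional.of_isCompact_closedBall 𝕜 hr
      ((hK n).of_isClosed_subset Metric.isClosed_closedBall hxr))
  rw [interior_eq_empty_iff_dense_compl, compl_iUnion]
  exact hdense.mono (iInter_mono fun n => compl_subset_compl.2 subset_closure)


theorem theorem3p3 {𝕜 X : Type*} [RCLike 𝕜] [NormedAddCommGroup X] [NormedSpace 𝕜 X]
    [NormedSpace ℝ X] [IsScalarTower ℝ 𝕜 X] [CompleteSpace X]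
    (A : X →ₗ.[𝕜] X) (S : ℝ → X →L[𝕜] X) (hS : IsC0Semigroup S)
    (hA : IsInfinitesimalGenerator A S)
    (m : ℕ) (f : Fin m → ℝ → X → X)
    (hf : ∀ i, ContinuousOn (fun p : ℝ × X => f i p.1 p.2) (Ici 0 ×ˢ univ))
    (hA1 : ∀ i, LipschitzOnBoundedSets (f i))
    (hA2 : ∀ i, LinearlyBounded (f i)) (ξ₀ : X) :
    (∃ K : ℕ → Set X, (∀ n, IsCompact (closure (K n))) ∧ reachableSet S f ξ₀ = ⋃ n, K n) ∧
      (¬ FiniteDimensional 𝕜 X → interior (reachableSet S f ξ₀) = ∅) := by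
  have hK : ∀ n : ℕ, IsCompact (closure (massReachableSet S f ξ₀ n n)) := fun n =>
    (totallyBounded_massReachableSet hS hf hA1 hA2 ξ₀ n.cast_nonneg n).closure.isCompact_of_isClosed
      isClosed_closure
  refine ⟨⟨_, hK, reachableSet_eq_iUnion S f ξ₀⟩, fun hX => ?_⟩
  rw [reachableSet_eq_iUnion]
  exact interior_iUnion_eq_empty_of_isCompact_closure 𝕜 hX hK
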